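/- Let $G=(V,E)$ be a finite undirected graph with edge probabilities $p_e\in[0,1]$ $(e\in E)$, acceptance probabilities $\theta_u\in[0,1]$ $(u\in V)$, an integer $k\ge 0$, and positive integers $R_0\ge R_1\ge\dots\ge R_k$. A realization $\phi$ assigns a state in $\{0,1\}$ to every user $u\in V$ and every edge $e\in E$; in the random realization $\Phi$ all states are independent, with $\Pr[\Phi(u)=1]=\theta_u$ and $\Pr[\Phi(e)=1]=p_e$. For a set $H\subseteq V$ of invited users put $D_0=\{u\in H:\phi(u)=1\}$ and $D_i=\{u:\exists v\in D_{i-1},\ \{u,v\}\in E,\ \phi(\{u,v\})=1\}\setminus\bigcup_{j<i}D_j$ for $1\le i\le k$; the revenue is $f(H,\phi)=\sum_{i=0}^k R_i\,|D_i|$. An adaptive policy $\pi$ invites users one at a time, choosing the next user (or stopping) as a function of the observations $\psi$ made so far. When $u$ is invited, her state is observed; if she accepts, so are the states of all edges incident to the users that are $i$-hop participants following $u$ for some $i<k$ (that is, those in the set $D_i$ formed for $H=\{u\}$). Let $H(\pi,\phi)$ be the set of users invited by $\pi$ under $\phi$, and $f_{avg}(\pi)=\mathbb{E}[f(H(\pi,\Phi),\Phi)]$.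 The problem RMSB with size budget $b\in\mathbb{N}$ is to maximize $f_{avg}(\pi)$ subject to $|H(\pi,\phi)|\le b$ for all realizations $\phi$. With $dx(\psi)$ the set of users invited so far and $\Phi\sim\psi$ meaning that $\Phi$ agrees with the observations $\psi$, let $\Delta(u\mid\psi)=\mathbb{E}[f(dx(\psi)\cup\{u\},\Phi)-f(dx(\psi),\Phi)\mid\Phi\sim\psi]$. The adaptive greedy policy $\pi^s$ (RMSBSolver) invites at each step a not yet invited user that maximizes $\Delta(\cdot\mid\psi)$, ties being broken arbitrarily, until $b$ users have been invited or no user is left. Suppose that $k\le 1$ or that $p_e=1$ for all $e\in E$. Then $\pi^s$ is feasible for RMSB, and $$f_{avg}(\pi^s)\ \ge\ (1-1/e)\,f_{avg}(\pi)$$ for every policy $\pi$ with $|H(\pi,\phi)|\le b$ for all $\phi$; in particular this holds for an optimal policy $\pi=\pi^*$. (In the factor $1-1/e$, $e$ is the base of the natural logarithm.) -/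

import Mathlib

/-- The data of a `k`-hop Collaborate Game on the undirected graph `G`: edge probabilities `p`,
acceptance vector `θ`, hop number `k`, and a revenue vector `R = (R_0, …, R_k)` of positive
integers with `R_0 ≥ R_1 ≥ … ≥ R_k`. -/
structure CollaborateGame {V : Type*} (G : SimpleGraph V) where
  p : G.edgeSet → ℝ
  p_mem : ∀ e, p e ∈ Set.Icc (0 : ℝ) 1
  θ : V → ℝ
  θ_mem : ∀ u, θ u ∈ Set.Icc (0 : ℝ) 1
  k : ℕ
  R : Fin (k + 1) → ℕ
  R_pos : ∀ i, 0 < R i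
  R_antitone : Antitone R

/-- A (full) realization: the state `0`/`1` of every user (does she accept to be an initiator
when the company invites her?) and of every edge (is the invitation along it accepted?). -/
abbrev Realization {V : Type*} (G : SimpleGraph V) := (V → Bool) × (G.edgeSet → Bool)

/-- A partial realization: the states observed so far; `none` is the unknown state `?`. -/
abbrev PartialRealization {V : Type*} (G : SimpleGraph V) :=
  (V → Option Bool) × (G.edgeSet → Option Bool)

/-- A (deterministic) adaptive policy: the next user to invite as a function of the current
observations, `none` meaning that the policy stops. Inviting a user again gives no new
observation, so it amounts to stopping. -/
abbrev Policy {V : Type*} (G : SimpleGraph V) := PartialRealization G → Option V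

section

variable {V : Type*} {G : SimpleGraph V}

/-- The initial partial realization: everything is unknown. -/
def PartialRealization.empty : PartialRealization G := (fun _ => none, fun _ => none)

/-- `φ ∼ ψ`: the realization `φ` agrees with `ψ` on the domain of `ψ`. -/
def Consistent (φ : Realization G) (ψ : PartialRealization G) : Prop :=
  (∀ u, ∀ s ∈ ψ.1 u, φ.1 u = s) ∧ (∀ e, ∀ s ∈ ψ.2 e, φ.2 e = s)

instance [Fintype V] [DecidableEq V] [DecidableRel G.Adj] (φ : Realization G)
    (ψ : PartialRealization G) : Decidable (Consistent φ ψ) :=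
  inferInstanceAs (Decidable (_ ∧ _))

/-- The observed users `dx(ψ)`, that is, the users invited so far. -/
def dx [Fintype V] (ψ : PartialRealization G) : Finset V :=
  Finset.univ.filter fun u => (ψ.1 u).isSome

/-- `{u, v}` is an edge of `G` whose state under `φ` is `1`. -/
def Live (φ : Realization G) (u v : V) : Prop :=
  ∃ h : G.Adj u v, φ.2 ⟨s(u, v), h⟩ = true

instance [DecidableRel G.Adj] (φ : Realization G) (u v : V) : Decidable (Live φ u v) :=
  inferInstanceAs (Decidable (∃ h : G.Adj u v, φ.2 ⟨s(u, v), h⟩ = true))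

variable [Fintype V] [DecidableEq V] [DecidableRel G.Adj]

/-- For a set `A` of initiators, the pair consisting of the set `D_i` of `i`-hop participants and
the union `D_0 ∪ … ∪ D_i`, where `D_0 = A` and
`D_i = {u | ∃ v ∈ D_{i-1}, φ({u, v}) = 1} \ (D_0 ∪ … ∪ D_{i-1})`. -/
def hopAux (φ : Realization G) (A : Finset V) : ℕ → Finset V × Finset V
  | 0 => (A, A)
  | i + 1 =>
    let prev := hopAux φ A i
    let new := (Finset.univ.filter fun u => ∃ v ∈ prev.1, Live φ u v) \ prev.2
    (new, prev.2 ∪ new)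

/-- The set `D_i` of `i`-hop participants when the users of `H` have been invited and the
realization is `φ`; `D_0` consists of the users of `H` who accept. -/
def participants (φ : Realization G) (H : Finset V) (i : ℕ) : Finset V :=
  (hopAux φ (H.filter fun u => φ.1 u = true) i).1

/-- The edges along which an invitation is sent when `u` is invited by the company: if `u` accepts,
these are the edges at the `i`-hop participants that follow `u`, for `i < k`; if `u` rejects,
there are none. -/
def RevealedEdge (k : ℕ) (φ : Realization G) (u : V) (e : G.edgeSet) : Prop :=
  ∃ i < k, ∃ v ∈ participants φ {u} i, v ∈ (e : Sym2 V)

instance (k : ℕ) (φ : Realization G) (u : V) (e : G.edgeSet) :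
    Decidable (RevealedEdge k φ u e) :=
  inferInstanceAs (Decidable (∃ i < k, ∃ v ∈ participants φ {u} i, v ∈ (e : Sym2 V)))

/-- The observations after inviting `u`, starting from the observations `ψ`, when the true
realization is `φ`: the state of `u` and the states of the revealed edges are added. -/
def observe (k : ℕ) (φ : Realization G) (ψ : PartialRealization G) (u : V) :
    PartialRealization G :=
  (fun v => if v = u then some (φ.1 v) else ψ.1 v,
   fun e => if RevealedEdge k φ u e then some (φ.2 e) else ψ.2 e)

namespace CollaborateGame

variable (N : CollaborateGame G)

/-- The probability of a realization: all states are independent, a user `u` has state `1` with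
probability `θ u` and an edge `e` has state `1` with probability `p e`. -/
def prob (φ : Realization G) : ℝ :=
  (∏ u, if φ.1 u = true then N.θ u else 1 - N.θ u) *
    ∏ e, if φ.2 e = true then N.p e else 1 - N.p e

/-- The total revenue `f(H, φ) = ∑_{i ≤ k} ∑_{u ∈ D_i} R_i`. -/
def revenue (H : Finset V) (φ : Realization G) : ℝ :=
  ∑ i : Fin (N.k + 1), ∑ _u ∈ participants φ H i, (N.R i : ℝ)

/-- One pick of the policy `π` under the realization `φ`. -/
def step (π : Policy G) (φ : Realization G) (ψ : PartialRealization G) : PartialRealization G :=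
  match π ψ with
  | none => ψ
  | some u => observe N.k φ ψ u

/-- `H(π, φ)`: the users invited by `π` under `φ`. Every pick except a last, idle one invites a
new user, so that `|V|` picks exhaust the run of the policy. -/
def invited (π : Policy G) (φ : Realization G) : Finset V :=
  dx ((N.step π φ)^[Fintype.card V] PartialRealization.empty)

/-- The expected revenue `f_avg(π) = 𝔼[f(H(π, Φ), Φ)]`. -/
def favg (π : Policy G) : ℝ :=
  ∑ φ : Realization G, N.prob φ * N.revenue (N.invited π φ) φ

/-- The size budget: `|H(π, φ)| ≤ b` for all realizations `φ`. -/
def Feasible (b : ℕ) (π : Policy G) : Prop :=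
  ∀ φ : Realization G, (N.invited π φ).card ≤ b

/-- `Pr[Φ ∼ ψ]`. -/
def probConsistent (ψ : PartialRealization G) : ℝ :=
  ∑ φ : Realization G with Consistent φ ψ, N.prob φ

/-- The conditional expected marginal benefit
`Δ(u | ψ) = 𝔼[f(dx(ψ) ∪ {u}, Φ) - f(dx(ψ), Φ) | Φ ∼ ψ]`, meaningful when `Pr[Φ ∼ ψ] > 0`. -/
noncomputable def marginal (u : V) (ψ : PartialRealization G) : ℝ :=
  (∑ φ : Realization G with Consistent φ ψ,
    N.prob φ * (N.revenue (dx ψ ∪ {u}) φ - N.revenue (dx ψ) φ)) / N.probConsistent ψ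

/-- `π` is an adaptive greedy policy with size budget `b`: as long as fewer than `b` users have been
invited and some user has not, it invites a not yet invited user with the largest conditional
expected marginal benefit (ties broken arbitrarily); then it stops. On observations of
probability zero the benefit is undefined and any new user may be invited. -/
def IsAdaptiveGreedy (b : ℕ) (π : Policy G) : Prop :=
  ∀ ψ : PartialRealization G,
    if (dx ψ).card < b ∧ dx ψ ≠ Finset.univ then
      ∃ u, π ψ = some u ∧ u ∉ dx ψ ∧
        (0 < N.probConsistent ψ → ∀ v, v ∉ dx ψ → N.marginal v ψ ≤ N.marginal u ψ)
    else π ψ = none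

/-- Adaptive greedy policies exist. -/
theorem exists_isAdaptiveGreedy (b : ℕ) : ∃ π : Policy G, N.IsAdaptiveGreedy b π := by
  refine Classical.axiom_of_choice (r := fun (ψ : PartialRealization G) (o : Option V) =>
    if (dx ψ).card < b ∧ dx ψ ≠ Finset.univ then
      ∃ u, o = some u ∧ u ∉ dx ψ ∧
        (0 < N.probConsistent ψ → ∀ v, v ∉ dx ψ → N.marginal v ψ ≤ N.marginal u ψ)
    else o = none) fun ψ => ?_
  split_ifs with h
  · have hne : (dx ψ)ᶜ.Nonempty := by
      rw [Finset.nonempty_iff_ne_empty, Ne, Finset.compl_eq_empty_iff]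
      exact h.2
    obtain ⟨u, hu, hmax⟩ := Finset.exists_max_image _ (fun v => N.marginal v ψ) hne
    exact ⟨some u, u, rfl, Finset.mem_compl.mp hu,
      fun _ v hv => hmax v (Finset.mem_compl.mpr hv)⟩
  · exact ⟨none, rfl⟩

end CollaborateGame

end

section

/-! Summation by parts, with R_{k+1} = 0, turns the revenue into the sum over i ≤ k of (R_i -
R_{i+1}) times the number of users within i hops of the initiators. This is a nonnegative
combination of coverage functions (`revenue_eq`), hence monotone. The observations determine the
sets covered by the invited users at every level i ≤ k (`reach_eq_of_consistent`). So the marginal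
benefit of u is a weighted sum, over the users v not yet covered, of the conditional probability
that u accepts and reaches v.

The case hypothesis makes that probability a constant q i u v that does not depend on the
observations (`exists_sum_hit`). If all edges are certain, only the state of u is random. If k ≤ 1,
only the state of u and possibly the edge uv matter; that edge can have been revealed only by u, who
is not yet invited, or by v as an initiator, and then v is already covered. With more hops, random
edges at users who are not initiators get revealed, and this independence may fail. Hence the
marginal benefit depends on the observations only through the uncovered sets, which shrink as more
users are invited: this is adaptive submodularity (`marginal_le_marginal`).

The rest is the adaptive greedy argument. Imagine running a feasible policy π on top of the users S
invited by greedy so far. Each new pick gains at most the largest marginal benefit M right after S,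
and there are at most b picks, so the advantage of π is at most b·M (`sum_advantage_le`). As M is
the expected gain of the next greedy pick, averaging over observations shows that each pick closes a
fraction 1/b of the gap to π (`sum_gap_le`). After b picks at most (1 - 1/b)^b ≤ 1/e of the gap
remains. -/

set_option linter.unusedSectionVars false

/-! ### Independence of one Bernoulli coordinate -/

/-- For independent coordinates in `{0, 1}`, the state of one coordinate is independent of every
function of the others. -/
theorem sum_bernoulli_mul_coord {α : Type*} [Fintype α] [DecidableEq α] (p : α → ℝ) (a : α)
    (g : (α → Bool) → ℝ) (hg : ∀ x c, g (Function.update x a c) = g x) :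
    ∑ x, (∏ i, if x i = true then p i else 1 - p i) * (if x a = true then g x else 0) =
      p a * ∑ x, (∏ i, if x i = true then p i else 1 - p i) * g x := by
  -- The weight of all coordinates other than `a`, times `g`: it does not depend on coordinate `a`.
  set h : (α → Bool) → ℝ := fun x =>
    (∏ i ∈ Finset.univ.erase a, if x i = true then p i else 1 - p i) * g x with hh
  have hinv : ∀ x c, h (Function.update x a c) = h x := by
    intro x c
    simp only [hh, hg]
    congr 1
    refine Finset.prod_congr rfl fun i hi => ?_
    rw [Function.update_of_ne (Finset.ne_of_mem_erase hi)]
  have hsplit : ∀ x : α → Bool, (∏ i, if x i = true then p i else 1 - p i) =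
      (if x a = true then p a else 1 - p a) *
        ∏ i ∈ Finset.univ.erase a, if x i = true then p i else 1 - p i :=
    fun x => (Finset.mul_prod_erase _ _ (Finset.mem_univ a)).symm
  -- Flipping coordinate `a` is an involution that preserves `h` and exchanges the two halves of the
  -- cube.
  have hflip : ∑ x : α → Bool, (if x a = true then 0 else h x) =
      ∑ x : α → Bool, (if x a = true then h x else 0) := by
    have hinvol : Function.Involutive fun x : α → Bool => Function.update x a (!x a) := by
      intro x
      simp
    rw [← Equiv.sum_comp hinvol.toPerm]
    refine Finset.sum_congr rfl fun x _ => ?_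
    simp only [Function.Involutive.coe_toPerm, Function.update_self, hinv]
    cases x a <;> simp
  have hL : ∀ x : α → Bool, (∏ i, if x i = true then p i else 1 - p i) *
      (if x a = true then g x else 0) = p a * (if x a = true then h x else 0) := by
    intro x
    rw [hsplit]
    split_ifs <;> simp [hh, mul_assoc]
  have hR : ∀ x : α → Bool, (∏ i, if x i = true then p i else 1 - p i) * g x =
      p a * (if x a = true then h x else 0) + (1 - p a) * (if x a = true then 0 else h x) := by
    intro x
    rw [hsplit]
    split_ifs <;> simp [hh, mul_assoc]
  rw [Finset.sum_congr rfl fun x _ => hL x, Finset.sum_congr rfl fun x _ => hR x,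
    Finset.sum_add_distrib, ← Finset.mul_sum, ← Finset.mul_sum, hflip]
  ring

variable {V : Type*} {G : SimpleGraph V}
variable [Fintype V] [DecidableEq V] [DecidableRel G.Adj]

/-! ### Hop balls as coverage sets -/

/-- The users within at most `i` hops of the initiators `A`. -/
def reach (φ : Realization G) (A : Finset V) (i : ℕ) : Finset V := (hopAux φ A i).2

/-- The users of `H` who accept. -/
def accepted (φ : Realization G) (H : Finset V) : Finset V := H.filter fun u => φ.1 u = true

theorem mem_hopAux_succ {φ : Realization G} {A : Finset V} {i : ℕ} {u : V} :
    u ∈ (hopAux φ A (i + 1)).1 ↔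
      (∃ v ∈ (hopAux φ A i).1, Live φ u v) ∧ u ∉ reach φ A i := by
  simp [hopAux, reach]

theorem reach_succ (φ : Realization G) (A : Finset V) (i : ℕ) :
    reach φ A (i + 1) = reach φ A i ∪ (hopAux φ A (i + 1)).1 := rfl

theorem mem_reach_succ_of_mem {φ : Realization G} {A : Finset V} {i : ℕ} {u : V}
    (h : u ∈ (hopAux φ A i).1) {w : V} (hw : Live φ w u) : w ∈ reach φ A (i + 1) := by
  rw [reach_succ, Finset.mem_union, mem_hopAux_succ]
  by_cases hwi : w ∈ reach φ A i
  · exact Or.inl hwi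
  · exact Or.inr ⟨⟨u, h, hw⟩, hwi⟩

/-- A user of the ball entered it at some level j ≤ i, so her live neighbours are covered at level j
+ 1 at the latest. -/
theorem mem_reach_succ_of_live {φ : Realization G} {A : Finset V} {i : ℕ} {u w : V}
    (h : u ∈ reach φ A i) (hw : Live φ w u) : w ∈ reach φ A (i + 1) := by
  induction i with
  | zero => exact mem_reach_succ_of_mem h hw
  | succ i ih =>
    rw [reach_succ, Finset.mem_union] at h
    rcases h with h | h
    · rw [reach_succ]
      exact Finset.mem_union_left _ (ih h)
    · exact mem_reach_succ_of_mem h hw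

theorem hopAux_fst_subset_reach (φ : Realization G) (A : Finset V) (i : ℕ) :
    (hopAux φ A i).1 ⊆ reach φ A i := by
  cases i with
  | zero => exact subset_rfl
  | succ i => exact Finset.subset_union_right

/-- This recursion avoids the set difference in the definition of the levels. Unlike the levels, the
balls therefore commute with unions of initiator sets. -/
theorem mem_reach_succ {φ : Realization G} {A : Finset V} {i : ℕ} {w : V} :
    w ∈ reach φ A (i + 1) ↔ w ∈ reach φ A i ∨ ∃ u ∈ reach φ A i, Live φ w u := by
  constructor
  · intro h
    rw [reach_succ, Finset.mem_union, mem_hopAux_succ] at h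
    rcases h with h | ⟨⟨v, hv, hl⟩, -⟩
    · exact Or.inl h
    · exact Or.inr ⟨v, hopAux_fst_subset_reach _ _ _ hv, hl⟩
  · rintro (h | ⟨u, hu, hl⟩)
    · rw [reach_succ]
      exact Finset.mem_union_left _ h
    · exact mem_reach_succ_of_live hu hl

theorem mem_reach_zero {φ : Realization G} {A : Finset V} {w : V} :
    w ∈ reach φ A 0 ↔ w ∈ A := Iff.rfl

theorem mem_reach_union {φ : Realization G} {A B : Finset V} {i : ℕ} {w : V} :
    w ∈ reach φ (A ∪ B) i ↔ w ∈ reach φ A i ∨ w ∈ reach φ B i := by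
  induction i generalizing w with
  | zero => simp [mem_reach_zero]
  | succ i ih =>
    simp only [mem_reach_succ, ih]
    constructor
    · rintro ((h | h) | ⟨u, h | h, hl⟩)
      exacts [.inl (.inl h), .inr (.inl h), .inl (.inr ⟨u, h, hl⟩), .inr (.inr ⟨u, h, hl⟩)]
    · rintro ((h | ⟨u, h, hl⟩) | (h | ⟨u, h, hl⟩))
      exacts [.inl (.inl h), .inr ⟨u, .inl h, hl⟩, .inl (.inr h), .inr ⟨u, .inr h, hl⟩]

theorem reach_union (φ : Realization G) (A B : Finset V) (i : ℕ) :
    reach φ (A ∪ B) i = reach φ A i ∪ reach φ B i := by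
  ext w
  rw [mem_reach_union, Finset.mem_union]

theorem reach_empty (φ : Realization G) (i : ℕ) : reach φ ∅ i = ∅ := by
  induction i with
  | zero => rfl
  | succ i ih =>
    ext w
    simp [mem_reach_succ, ih]

theorem reach_mono (φ : Realization G) {A B : Finset V} (h : A ⊆ B) (i : ℕ) :
    reach φ A i ⊆ reach φ B i := by
  rw [← Finset.union_eq_right.mpr h, reach_union]
  exact Finset.subset_union_left

theorem subset_reach (φ : Realization G) (A : Finset V) (i : ℕ) : A ⊆ reach φ A i := by
  induction i with
  | zero => exact subset_rfl
  | succ i ih => exact ih.trans fun w hw => mem_reach_succ.mpr (Or.inl hw)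

theorem accepted_union (φ : Realization G) (A B : Finset V) :
    accepted φ (A ∪ B) = accepted φ A ∪ accepted φ B := Finset.filter_union _ _ _

theorem accepted_mono (φ : Realization G) {A B : Finset V} (h : A ⊆ B) :
    accepted φ A ⊆ accepted φ B := Finset.filter_subset_filter _ h

theorem mem_accepted {φ : Realization G} {H : Finset V} {u : V} :
    u ∈ accepted φ H ↔ u ∈ H ∧ φ.1 u = true := Finset.mem_filter

theorem accepted_singleton_of_true {φ : Realization G} {u : V} (h : φ.1 u = true) :
    accepted φ {u} = {u} := by
  ext w
  simp only [mem_accepted, Finset.mem_singleton, and_iff_left_iff_imp]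
  rintro rfl
  exact h

theorem accepted_singleton_of_false {φ : Realization G} {u : V} (h : ¬ φ.1 u = true) :
    accepted φ {u} = ∅ := by
  ext w
  simp only [mem_accepted, Finset.mem_singleton, Finset.notMem_empty, iff_false]
  rintro ⟨rfl, h'⟩
  exact h h'

/-- Every user reached from the initiators in `H` is reached from one of them. -/
theorem mem_reach_accepted {φ : Realization G} {H : Finset V} {i : ℕ} {w : V} :
    w ∈ reach φ (accepted φ H) i ↔ ∃ a ∈ H, w ∈ reach φ (accepted φ {a}) i := by
  induction H using Finset.induction_on with
  | empty => simp [accepted, reach_empty]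
  | insert a H _ ih =>
    rw [Finset.insert_eq, accepted_union, mem_reach_union, ih]
    simp [or_and_right, exists_or]

theorem card_participants_succ (φ : Realization G) (H : Finset V) (i : ℕ) :
    ((participants φ H (i + 1)).card : ℝ) =
      (reach φ (accepted φ H) (i + 1)).card - (reach φ (accepted φ H) i).card := by
  rw [reach_succ, Finset.card_union_of_disjoint]
  · push_cast
    simp [participants, accepted]
  · rw [Finset.disjoint_right]
    exact fun w hw => (mem_hopAux_succ.mp hw).2

/-- Summation by parts. -/
theorem sum_mul_increment (r d l : ℕ → ℝ) (h0 : d 0 = l 0) (h : ∀ i, d (i + 1) = l (i + 1) - l i)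
    (k : ℕ) : ∑ i ∈ Finset.range (k + 1), r i * d i =
      ∑ i ∈ Finset.range (k + 1), (r i - r (i + 1)) * l i + r (k + 1) * l k := by
  induction k with
  | zero =>
    simp [h0]
    ring
  | succ k ih =>
    rw [Finset.sum_range_succ, ih, Finset.sum_range_succ _ (k + 1), h]
    ring

/-! ### Observations and what they determine -/

/-- The observations made by inviting the users of `S` under `φ`. -/
def obs (k : ℕ) (φ : Realization G) (S : Finset V) : PartialRealization G :=
  (fun v => if v ∈ S then some (φ.1 v) else none,
   fun e => if ∃ a ∈ S, RevealedEdge k φ a e then some (φ.2 e) else none)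

theorem dx_obs (k : ℕ) (φ : Realization G) (S : Finset V) : dx (obs k φ S) = S := by
  ext v
  by_cases h : v ∈ S <;> simp [dx, obs, h]

theorem obs_empty (k : ℕ) (φ : Realization G) : obs k φ ∅ = PartialRealization.empty := by
  simp [obs, PartialRealization.empty]

/-- Observations depend only on the set of invited users, not on the order of the invitations. -/
theorem observe_obs (k : ℕ) (φ : Realization G) (S : Finset V) (u : V) :
    observe k φ (obs k φ S) u = obs k φ (insert u S) := by
  refine Prod.ext (funext fun v => ?_) (funext fun e => ?_)
  · by_cases h1 : v = u <;> by_cases h2 : v ∈ S <;> simp [observe, obs, h1, h2]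
  · by_cases h1 : RevealedEdge k φ u e <;> by_cases h2 : ∃ a ∈ S, RevealedEdge k φ a e <;>
      simp [observe, obs, h1, h2]

theorem consistent_obs {k : ℕ} {φ φ' : Realization G} {S : Finset V} :
    Consistent φ' (obs k φ S) ↔ (∀ v ∈ S, φ'.1 v = φ.1 v) ∧
      ∀ a ∈ S, ∀ e, RevealedEdge k φ a e → φ'.2 e = φ.2 e := by
  constructor
  · rintro ⟨h1, h2⟩
    exact ⟨fun v hv => h1 v _ (by simp [obs, hv]),
      fun a ha e he => h2 e _ (by simp only [obs]; rw [if_pos ⟨a, ha, he⟩]; rfl)⟩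
  · rintro ⟨h1, h2⟩
    refine ⟨fun v s hs => ?_, fun e s hs => ?_⟩
    · by_cases hv : v ∈ S
      · simp only [obs, hv, if_true, Option.mem_def, Option.some.injEq] at hs
        rw [h1 v hv, hs]
      · simp [obs, hv] at hs
    · by_cases he : ∃ a ∈ S, RevealedEdge k φ a e
      · simp only [obs, if_pos he, Option.mem_def, Option.some.injEq] at hs
        obtain ⟨a, ha, he⟩ := he
        rw [h2 a ha e he, hs]
      · simp only [obs, if_neg he] at hs
        cases hs

theorem consistent_obs_self (k : ℕ) (φ : Realization G) (S : Finset V) :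
    Consistent φ (obs k φ S) := consistent_obs.mpr ⟨fun _ _ => rfl, fun _ _ _ _ => rfl⟩

theorem Consistent.mono_obs {k : ℕ} {φ φ' : Realization G} {S T : Finset V} (hST : S ⊆ T)
    (h : Consistent φ' (obs k φ T)) : Consistent φ' (obs k φ S) := by
  rw [consistent_obs] at h ⊢
  exact ⟨fun v hv => h.1 v (hST hv), fun a ha => h.2 a (hST ha)⟩

/-- The search up to level k consults only edges at participants of levels below k. -/
theorem hopAux_congr {φ φ' : Realization G} {A : Finset V} {k : ℕ}
    (h : ∀ i < k, ∀ v ∈ (hopAux φ A i).1, ∀ w, Live φ' w v ↔ Live φ w v) {i : ℕ} (hi : i ≤ k) :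
    hopAux φ' A i = hopAux φ A i := by
  induction i with
  | zero => rfl
  | succ i ih =>
    have ih := ih (Nat.le_of_succ_le hi)
    have hfst : (hopAux φ' A (i + 1)).1 = (hopAux φ A (i + 1)).1 := by
      ext w
      rw [mem_hopAux_succ, mem_hopAux_succ, reach, reach, ih]
      refine and_congr_left fun _ => exists_congr fun v => and_congr_right fun hv => ?_
      exact h i hi v hv w
    refine Prod.ext hfst ?_
    change reach φ' A i ∪ (hopAux φ' A (i + 1)).1 = reach φ A i ∪ (hopAux φ A (i + 1)).1
    rw [hfst, reach, reach, ih]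

theorem accepted_congr {φ φ' : Realization G} {S : Finset V} (h : ∀ v ∈ S, φ'.1 v = φ.1 v) :
    accepted φ' S = accepted φ S :=
  Finset.filter_congr fun v hv => by rw [h v hv]

/-- The participants that follow an invited user are known. -/
theorem hopAux_eq_of_consistent {k : ℕ} {φ φ' : Realization G} {S : Finset V}
    (h : Consistent φ' (obs k φ S)) {a : V} (ha : a ∈ S) {i : ℕ} (hi : i ≤ k) :
    hopAux φ' (accepted φ' {a}) i = hopAux φ (accepted φ {a}) i := by
  rw [consistent_obs] at h
  rw [accepted_congr (φ := φ) (φ' := φ') (S := {a})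
    fun v hv => h.1 v (by rwa [Finset.mem_singleton.mp hv])]
  -- Every edge the search consults is incident to a participant of level j < k, so it has been
  -- revealed.
  refine hopAux_congr (fun j hj v hv w => exists_congr fun hwv => ?_) hi
  rw [h.2 a ha _ ⟨j, hj, v, hv, Sym2.mem_mk_right w v⟩]

theorem reach_eq_of_consistent {k : ℕ} {φ φ' : Realization G} {S : Finset V}
    (h : Consistent φ' (obs k φ S)) {i : ℕ} (hi : i ≤ k) :
    reach φ' (accepted φ' S) i = reach φ (accepted φ S) i := by
  ext w
  rw [mem_reach_accepted, mem_reach_accepted]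
  refine exists_congr fun a => and_congr_right fun ha => ?_
  rw [reach, reach, hopAux_eq_of_consistent h ha hi]

/-- Two realizations agree on the observations of one of them exactly if they yield the same
observations. -/
theorem consistent_obs_iff_eq {k : ℕ} {φ φ' : Realization G} {S : Finset V} :
    Consistent φ' (obs k φ S) ↔ obs k φ' S = obs k φ S := by
  refine ⟨fun h => ?_, fun h => h ▸ consistent_obs_self k φ' S⟩
  -- Which edges are revealed is itself determined by the observations.
  have hr : ∀ a ∈ S, ∀ e, RevealedEdge k φ' a e ↔ RevealedEdge k φ a e := by
    intro a ha e
    refine exists_congr fun i => and_congr_right fun hi => ?_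
    have := hopAux_eq_of_consistent h ha hi.le
    simp only [accepted] at this
    rw [participants, participants, this]
  rw [consistent_obs] at h
  refine Prod.ext (funext fun v => ?_) (funext fun e => ?_)
  · by_cases hv : v ∈ S
    · simp [obs, hv, h.1 v hv]
    · simp [obs, hv]
  · have hiff : (∃ a ∈ S, RevealedEdge k φ' a e) ↔ ∃ a ∈ S, RevealedEdge k φ a e :=
      exists_congr fun a => and_congr_right fun ha => hr a ha e
    by_cases he : ∃ a ∈ S, RevealedEdge k φ a e
    · simp only [obs]
      rw [if_pos he, if_pos (hiff.mpr he)]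
      obtain ⟨a, ha, he⟩ := he
      rw [h.2 a ha e he]
    · simp only [obs]
      rw [if_neg he, if_neg (mt hiff.mp he)]

/-! ### The revenue as weighted coverage -/

namespace CollaborateGame

variable (N : CollaborateGame G)

/-- The revenue vector, extended by zero. -/
def extR (i : ℕ) : ℝ := if h : i < N.k + 1 then (N.R ⟨i, h⟩ : ℝ) else 0

/-- The decrements `R_i - R_{i+1}` of the revenue vector. -/
def weight (i : ℕ) : ℝ := N.extR i - N.extR (i + 1)

theorem weight_nonneg (i : ℕ) : 0 ≤ N.weight i := by
  rw [weight, sub_nonneg, extR, extR]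
  split_ifs with h1 h2
  · exact_mod_cast N.R_antitone (Fin.mk_le_mk.mpr (Nat.le_succ i))
  · omega
  · positivity
  · exact le_rfl

/-- The revenue is a nonnegative combination of coverage functions. -/
theorem revenue_eq (H : Finset V) (φ : Realization G) :
    N.revenue H φ =
      ∑ i ∈ Finset.range (N.k + 1), N.weight i * (reach φ (accepted φ H) i).card := by
  have h := sum_mul_increment N.extR (fun i => ((participants φ H i).card : ℝ))
    (fun i => ((reach φ (accepted φ H) i).card : ℝ)) rfl (card_participants_succ φ H) N.k
  -- The extension by zero kills the boundary term of the summation by parts.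
  have hz : N.extR (N.k + 1) = 0 := by simp [extR]
  rw [hz, zero_mul, add_zero] at h
  unfold weight
  rw [← h, revenue, Finset.sum_range]
  refine Finset.sum_congr rfl fun i _ => ?_
  rw [Finset.sum_const, nsmul_eq_mul, mul_comm, extR, dif_pos i.2]

theorem revenue_mono (φ : Realization G) {A B : Finset V} (h : A ⊆ B) :
    N.revenue A φ ≤ N.revenue B φ := by
  rw [revenue_eq, revenue_eq]
  refine Finset.sum_le_sum fun i _ => mul_le_mul_of_nonneg_left ?_ (N.weight_nonneg i)
  exact_mod_cast Finset.card_le_card (reach_mono φ (accepted_mono φ h) i)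

theorem revenue_nonneg (φ : Realization G) (A : Finset V) : 0 ≤ N.revenue A φ := by
  rw [revenue_eq]
  exact Finset.sum_nonneg fun i _ => mul_nonneg (N.weight_nonneg i) (Nat.cast_nonneg _)

theorem revenue_empty (φ : Realization G) : N.revenue ∅ φ = 0 := by
  rw [revenue_eq]
  simp [accepted, reach_empty]

/-- `1` if `u` accepts and reaches `v` within `i` hops, and `0` otherwise. -/
def hit (i : ℕ) (u v : V) (φ : Realization G) : ℝ :=
  if v ∈ reach φ (accepted φ {u}) i then 1 else 0

/-- Adding `u` enlarges each ball exactly by the users that `u` reaches and `S` does not. -/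
theorem revenue_union_sub (S : Finset V) (u : V) (φ : Realization G) :
    N.revenue (S ∪ {u}) φ - N.revenue S φ =
      ∑ i ∈ Finset.range (N.k + 1), ∑ v ∈ (reach φ (accepted φ S) i)ᶜ,
        N.weight i * hit i u v φ := by
  rw [revenue_eq, revenue_eq, ← Finset.sum_sub_distrib]
  refine Finset.sum_congr rfl fun i _ => ?_
  rw [← mul_sub, ← Finset.mul_sum, accepted_union, reach_union]
  congr 1
  simp only [hit]
  rw [Finset.sum_boole, sub_eq_iff_eq_add', ← Nat.cast_add, Finset.filter_mem_eq_inter,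
    ← Finset.card_union_of_disjoint]
  · congr 2
    ext w
    simp only [Finset.mem_union, Finset.mem_inter, Finset.mem_compl]
    tauto
  · exact Finset.disjoint_left.mpr fun w hw hw' =>
      Finset.mem_compl.mp (Finset.mem_inter.mp hw').1 hw

theorem prob_nonneg (φ : Realization G) : 0 ≤ N.prob φ := by
  refine mul_nonneg (Finset.prod_nonneg fun u _ => ?_) (Finset.prod_nonneg fun e _ => ?_)
  · have := N.θ_mem u
    split_ifs
    exacts [this.1, sub_nonneg.mpr this.2]
  · have := N.p_mem e
    split_ifs
    exacts [this.1, sub_nonneg.mpr this.2]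

end CollaborateGame

/-! ### Unobserved states are independent of the observations -/

theorem consistent_update_user {ψ : PartialRealization G} {u : V} (hu : ψ.1 u = none)
    (φ : Realization G) (c : Bool) :
    Consistent (Function.update φ.1 u c, φ.2) ψ ↔ Consistent φ ψ := by
  refine and_congr_left fun _ => forall_congr' fun v => ?_
  by_cases h : v = u
  · subst h
    simp [hu]
  · simp [Function.update_of_ne h]

theorem consistent_update_edge {ψ : PartialRealization G} {e : G.edgeSet} (he : ψ.2 e = none)
    (φ : Realization G) (c : Bool) :
    Consistent (φ.1, Function.update φ.2 e c) ψ ↔ Consistent φ ψ := by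
  refine and_congr_right fun _ => forall_congr' fun v => ?_
  by_cases h : v = e
  · subst h
    simp [he]
  · simp [Function.update_of_ne h]

theorem revealedEdge_one {φ : Realization G} {a : V} {e : G.edgeSet} :
    RevealedEdge 1 φ a e ↔ φ.1 a = true ∧ a ∈ (e : Sym2 V) := by
  simp only [RevealedEdge, Nat.lt_one_iff, exists_eq_left]
  change (∃ v ∈ accepted φ {a}, v ∈ (e : Sym2 V)) ↔ _
  simp only [mem_accepted, Finset.mem_singleton]
  constructor
  · rintro ⟨v, ⟨rfl, h1⟩, h2⟩
    exact ⟨h1, h2⟩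
  · rintro ⟨h1, h2⟩
    exact ⟨a, ⟨rfl, h1⟩, h2⟩

/-- With one hop, an edge joining a user not yet invited to a user who is no initiator has not been
observed. -/
theorem obs_one_edge_eq_none {φ : Realization G} {S : Finset V} {u v : V} (h : G.Adj v u)
    (hu : u ∉ S) (hv : v ∉ accepted φ S) : (obs 1 φ S).2 ⟨s(v, u), h⟩ = none := by
  simp only [obs]
  rw [if_neg]
  rintro ⟨a, ha, hr⟩
  rw [revealedEdge_one] at hr
  rcases Sym2.mem_iff.mp hr.2 with rfl | rfl
  · exact hv (mem_accepted.mpr ⟨ha, hr.1⟩)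
  · exact hu ha

theorem mem_reach_singleton_one {φ : Realization G} {u v : V} :
    v ∈ reach φ {u} 1 ↔ v = u ∨ Live φ v u := by
  simp [mem_reach_succ, mem_reach_zero]

namespace CollaborateGame

variable (N : CollaborateGame G)

theorem hit_eq (i : ℕ) (u v : V) (φ : Realization G) :
    hit i u v φ = if φ.1 u = true then (if v ∈ reach φ {u} i then 1 else 0) else 0 := by
  unfold hit
  by_cases h : φ.1 u = true
  · rw [accepted_singleton_of_true h, if_pos h]
  · rw [accepted_singleton_of_false h, if_neg h, reach_empty]
    simp

theorem sum_prob_user (u : V) (g : Realization G → ℝ)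
    (hg : ∀ φ c, g (Function.update φ.1 u c, φ.2) = g φ) :
    ∑ φ, N.prob φ * (if φ.1 u = true then g φ else 0) = N.θ u * ∑ φ, N.prob φ * g φ := by
  rw [Fintype.sum_prod_type_right, Fintype.sum_prod_type_right, Finset.mul_sum]
  refine Finset.sum_congr rfl fun y _ => ?_
  have h := sum_bernoulli_mul_coord N.θ u (fun x => g (x, y)) fun x c => hg (x, y) c
  have hc : ∀ F : (V → Bool) → ℝ, ∑ x, N.prob (x, y) * F x =
      (∏ e, if y e = true then N.p e else 1 - N.p e) *
        ∑ x, (∏ i, if x i = true then N.θ i else 1 - N.θ i) * F x := by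
    intro F
    rw [Finset.mul_sum]
    refine Finset.sum_congr rfl fun x _ => ?_
    simp only [prob]
    ring
  rw [hc (fun x => if x u = true then g (x, y) else 0), hc (fun x => g (x, y)), h]
  ring

theorem sum_prob_edge (e : G.edgeSet) (g : Realization G → ℝ)
    (hg : ∀ φ c, g (φ.1, Function.update φ.2 e c) = g φ) :
    ∑ φ, N.prob φ * (if φ.2 e = true then g φ else 0) = N.p e * ∑ φ, N.prob φ * g φ := by
  rw [Fintype.sum_prod_type, Fintype.sum_prod_type, Finset.mul_sum]
  refine Finset.sum_congr rfl fun x _ => ?_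
  have h := sum_bernoulli_mul_coord N.p e (fun y => g (x, y)) fun y c => hg (x, y) c
  have hc : ∀ F : (G.edgeSet → Bool) → ℝ, ∑ y, N.prob (x, y) * F y =
      (∏ u, if x u = true then N.θ u else 1 - N.θ u) *
        ∑ y, (∏ i, if y i = true then N.p i else 1 - N.p i) * F y := by
    intro F
    rw [Finset.mul_sum]
    refine Finset.sum_congr rfl fun x _ => ?_
    simp only [prob]
    ring
  rw [hc (fun y => if y e = true then g (x, y) else 0), hc (fun y => g (x, y)), h]
  ring

/-- If all edges are certain, only the realizations in which all edges are live matter. -/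
theorem reach_eq_of_prob_ne_zero (hp : ∀ e, N.p e = 1) {φ : Realization G} (hφ : N.prob φ ≠ 0)
    (A : Finset V) (i : ℕ) : reach φ A i = reach (G := G) (fun _ => true, fun _ => true) A i := by
  have hedge : ∀ e, φ.2 e = true := by
    intro e
    by_contra he
    refine hφ (mul_eq_zero_of_right _ (Finset.prod_eq_zero (Finset.mem_univ e) ?_))
    rw [if_neg he, hp, sub_self]
  rw [reach, reach, hopAux_congr (k := i) (fun _ _ v _ w => ?_) le_rfl]
  exact exists_congr fun h => by simp [hedge]

/-- The event that `u` accepts and reaches `v` is independent of all observations that involve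
neither `u` nor, in the case of one hop, the edge between `u` and `v`. -/
theorem exists_sum_hit (hcase : N.k ≤ 1 ∨ ∀ e : G.edgeSet, N.p e = 1) (i : ℕ) (u v : V) :
    ∃ q : ℝ, 0 ≤ q ∧ ∀ g : Realization G → ℝ,
      i ≤ N.k → (∀ φ c, g (Function.update φ.1 u c, φ.2) = g φ) →
      (N.k = 1 → ∀ h : G.Adj v u, ∀ φ c, g (φ.1, Function.update φ.2 ⟨s(v, u), h⟩ c) = g φ) →
      ∑ φ, N.prob φ * (hit i u v φ * g φ) = q * ∑ φ, N.prob φ * g φ := by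
  have hθ := (N.θ_mem u).1
  -- Whenever reaching `v` from `u` is almost surely decided (indicator `c`), only the acceptance of
  -- `u` is random and q = c·θ_u. All cases reduce to this except one hop along an edge.
  have hconst : ∀ c : ℝ, (i ≤ N.k → ∀ φ, N.prob φ ≠ 0 →
      (if v ∈ reach φ {u} i then (1 : ℝ) else 0) = c) → 0 ≤ c → ∃ q : ℝ, 0 ≤ q ∧
      ∀ g : Realization G → ℝ,
      i ≤ N.k → (∀ φ c, g (Function.update φ.1 u c, φ.2) = g φ) →
      (N.k = 1 → ∀ h : G.Adj v u, ∀ φ c, g (φ.1, Function.update φ.2 ⟨s(v, u), h⟩ c) = g φ) →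
      ∑ φ, N.prob φ * (hit i u v φ * g φ) = q * ∑ φ, N.prob φ * g φ := by
    intro c hc hc0
    refine ⟨c * N.θ u, mul_nonneg hc0 hθ, fun g hi hg _ => ?_⟩
    rw [mul_assoc, ← N.sum_prob_user u g hg, Finset.mul_sum]
    refine Finset.sum_congr rfl fun φ _ => ?_
    by_cases h0 : N.prob φ = 0
    · simp [h0]
    · rw [hit_eq, hc hi φ h0]
      split_ifs <;> ring
  rcases hcase with hk | hp
  · by_cases hvu : v = u
    · refine hconst 1 (fun _ φ _ => if_pos ?_) zero_le_one
      exact subset_reach φ _ _ (Finset.mem_singleton.mpr hvu)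
    by_cases hi1 : i = 1
    · subst hi1
      by_cases hadj : G.Adj v u
      · set e : G.edgeSet := ⟨s(v, u), hadj⟩ with he
        refine ⟨N.p e * N.θ u, mul_nonneg (N.p_mem e).1 hθ, fun g hi hg hg' => ?_⟩
        have hge := hg' (le_antisymm hk hi) hadj
        rw [mul_assoc, ← N.sum_prob_user u g hg,
          ← N.sum_prob_edge e (fun φ => if φ.1 u = true then g φ else 0)
            fun φ c => by simp only [hge φ c, he]]
        refine Finset.sum_congr rfl fun φ _ => ?_
        have hl : v ∈ reach φ {u} 1 ↔ φ.2 e = true := by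
          rw [mem_reach_singleton_one, or_iff_right hvu]
          exact ⟨fun ⟨_, h⟩ => h, fun h => ⟨hadj, h⟩⟩
        rw [hit_eq]
        simp only [hl]
        split_ifs <;> simp
      · refine hconst 0 (fun _ φ _ => if_neg ?_) le_rfl
        rw [mem_reach_singleton_one]
        rintro (h | ⟨h, -⟩)
        exacts [hvu h, hadj h]
    -- Since i ≤ k ≤ 1 and i ≠ 1, only i = 0 is left, where `u` reaches only herself.
    · refine hconst 0 (fun hi φ _ => if_neg ?_) le_rfl
      obtain rfl : i = 0 := by omega
      simpa [mem_reach_zero] using hvu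
  · refine hconst (if v ∈ reach (G := G) (fun _ => true, fun _ => true) {u} i then 1 else 0)
      (fun _ φ hφ => ?_) (by split_ifs <;> norm_num)
    rw [N.reach_eq_of_prob_ne_zero hp hφ]

/-! ### Marginal benefits and adaptive submodularity -/

theorem probConsistent_eq (ψ : PartialRealization G) :
    N.probConsistent ψ = ∑ φ, N.prob φ * (if Consistent φ ψ then 1 else 0) := by
  simp [probConsistent, Finset.sum_filter]

/-- The marginal benefit of `u` is the weighted sum, over the users `v` not yet reached, of the
probabilities that `u` accepts and reaches `v`. -/
theorem exists_marginal_eq (hcase : N.k ≤ 1 ∨ ∀ e : G.edgeSet, N.p e = 1) :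
    ∃ q : ℕ → V → V → ℝ, (∀ i u v, 0 ≤ q i u v) ∧ ∀ (φ₀ : Realization G) (S : Finset V) (u : V),
      u ∉ S → 0 < N.probConsistent (obs N.k φ₀ S) →
      N.marginal u (obs N.k φ₀ S) = ∑ i ∈ Finset.range (N.k + 1),
        ∑ v ∈ (reach φ₀ (accepted φ₀ S) i)ᶜ, N.weight i * q i u v := by
  choose q hq0 hq using N.exists_sum_hit hcase
  refine ⟨q, hq0, fun φ₀ S u hu hpos => ?_⟩
  rw [marginal, div_eq_iff hpos.ne', dx_obs]
  have h1 : ∀ φ ∈ Finset.univ.filter fun φ => Consistent φ (obs N.k φ₀ S),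
      N.prob φ * (N.revenue (S ∪ {u}) φ - N.revenue S φ) = ∑ i ∈ Finset.range (N.k + 1),
        ∑ v ∈ (reach φ₀ (accepted φ₀ S) i)ᶜ, N.weight i * (N.prob φ * hit i u v φ) := by
    intro φ hφ
    rw [revenue_union_sub, Finset.mul_sum]
    refine Finset.sum_congr rfl fun i hi => ?_
    -- The covered set is the same for all consistent realizations, so the range of summation may be
    -- fixed by `φ₀`.
    rw [reach_eq_of_consistent (Finset.mem_filter.mp hφ).2 (Finset.mem_range_succ_iff.mp hi),
      Finset.mul_sum]
    exact Finset.sum_congr rfl fun v _ => by ring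
  rw [Finset.sum_congr rfl h1, Finset.sum_comm, Finset.sum_mul]
  refine Finset.sum_congr rfl fun i hi => ?_
  rw [Finset.sum_comm, Finset.sum_mul]
  refine Finset.sum_congr rfl fun v hv => ?_
  rw [← Finset.mul_sum, mul_assoc, probConsistent_eq,
    ← hq i u v _ (Finset.mem_range_succ_iff.mp hi)]
  · rw [Finset.sum_filter]
    congr 1
    refine Finset.sum_congr rfl fun φ _ => ?_
    split_ifs <;> simp
  · intro φ c
    simp only [consistent_update_user (show (obs N.k φ₀ S).1 u = none by simp [obs, hu])]
  · intro hk h φ c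
    -- An uncovered user is in particular no initiator, so the edge from her to the uninvited `u` is
    -- still unobserved.
    have hv' : v ∉ accepted φ₀ S :=
      fun hmem => Finset.mem_compl.mp hv (subset_reach _ _ _ hmem)
    have hnone : (obs N.k φ₀ S).2 ⟨s(v, u), h⟩ = none := by
      rw [hk]
      exact obs_one_edge_eq_none h hu hv'
    simp only [consistent_update_edge hnone]

theorem probConsistent_nonneg (ψ : PartialRealization G) : 0 ≤ N.probConsistent ψ :=
  Finset.sum_nonneg fun φ _ => N.prob_nonneg φ

/-- Adaptive submodularity. -/
theorem marginal_le_marginal (hcase : N.k ≤ 1 ∨ ∀ e : G.edgeSet, N.p e = 1) {φ : Realization G}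
    {S T : Finset V} (hST : S ⊆ T) {u : V} (hu : u ∉ T)
    (hpos : 0 < N.probConsistent (obs N.k φ T)) :
    N.marginal u (obs N.k φ T) ≤ N.marginal u (obs N.k φ S) := by
  obtain ⟨q, hq0, hq⟩ := N.exists_marginal_eq hcase
  have hpos' : 0 < N.probConsistent (obs N.k φ S) := by
    refine hpos.trans_le (Finset.sum_le_sum_of_subset_of_nonneg ?_ fun φ _ _ => N.prob_nonneg φ)
    exact Finset.monotone_filter_right _ fun φ' _ h => h.mono_obs hST
  rw [hq φ T u hu hpos, hq φ S u (fun h => hu (hST h)) hpos']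
  refine Finset.sum_le_sum fun i _ => Finset.sum_le_sum_of_subset_of_nonneg ?_
    fun v _ _ => mul_nonneg (N.weight_nonneg i) (hq0 i u v)
  -- The coefficients are the same for both observations; only the set of uncovered users shrinks.
  exact Finset.compl_subset_compl.mpr (reach_mono _ (accepted_mono _ hST) _)

theorem marginal_nonneg (u : V) (ψ : PartialRealization G) : 0 ≤ N.marginal u ψ :=
  div_nonneg (Finset.sum_nonneg fun φ _ => mul_nonneg (N.prob_nonneg φ)
    (sub_nonneg.mpr (N.revenue_mono φ Finset.subset_union_left))) (N.probConsistent_nonneg ψ)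

end CollaborateGame

/-! ### Conditioning on observations and runs of policies -/

/-- An inequality of sums over realizations may be checked conditionally on an observation. -/
theorem sum_le_sum_of_observation {P : Realization G → Prop} [DecidablePred P]
    {ρ : Realization G → PartialRealization G}
    (hρ : ∀ φ, P φ → ∀ φ', Consistent φ' (ρ φ) ↔ P φ' ∧ ρ φ' = ρ φ) {F F' : Realization G → ℝ}
    (h : ∀ φ, P φ → ∑ φ' : Realization G with Consistent φ' (ρ φ), F φ' ≤
      ∑ φ' : Realization G with Consistent φ' (ρ φ), F' φ') :
    ∑ φ : Realization G with P φ, F φ ≤ ∑ φ : Realization G with P φ, F' φ := by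
  have hmaps : ∀ φ ∈ Finset.univ.filter P, ρ φ ∈ (Finset.univ.filter P).image ρ :=
    fun φ hφ => Finset.mem_image_of_mem ρ hφ
  -- The fibres of `ρ` partition the event `P`, and by `hρ` each fibre is the set of realizations
  -- consistent with its observation.
  rw [← Finset.sum_fiberwise_of_maps_to hmaps F, ← Finset.sum_fiberwise_of_maps_to hmaps F']
  refine Finset.sum_le_sum fun ψ hψ => ?_
  obtain ⟨φ, hφ, rfl⟩ := Finset.mem_image.mp hψ
  have hP := (Finset.mem_filter.mp hφ).2
  rw [Finset.filter_filter, ← Finset.filter_congr fun φ' _ => hρ φ hP φ']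
  exact h φ hP

namespace CollaborateGame

variable (N : CollaborateGame G)

/-- The users invited in the first `t` picks. -/
def hist (π : Policy G) (φ : Realization G) (t : ℕ) : Finset V :=
  dx ((N.step π φ)^[t] PartialRealization.empty)

/-- Every state of a run is the observation of the set invited so far, so a run can be followed
through the sets `hist` alone. -/
theorem iterate_step_eq_obs (π : Policy G) (φ : Realization G) (t : ℕ) :
    (N.step π φ)^[t] PartialRealization.empty = obs N.k φ (N.hist π φ t) := by
  have h : ∃ S, (N.step π φ)^[t] PartialRealization.empty = obs N.k φ S := by
    induction t with
    | zero => exact ⟨∅, (obs_empty N.k φ).symm⟩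
    | succ t ih =>
      obtain ⟨S, hS⟩ := ih
      rw [Function.iterate_succ_apply', hS, step]
      cases π (obs N.k φ S) with
      | none => exact ⟨S, rfl⟩
      | some u => exact ⟨insert u S, observe_obs N.k φ S u⟩
  obtain ⟨S, hS⟩ := h
  rw [hist, hS, dx_obs]

theorem hist_zero (π : Policy G) (φ : Realization G) : N.hist π φ 0 = ∅ := by
  rw [hist, Function.iterate_zero, id, ← obs_empty N.k φ, dx_obs]

theorem hist_succ_of_none {π : Policy G} {φ : Realization G} {t : ℕ}
    (h : π (obs N.k φ (N.hist π φ t)) = none) : N.hist π φ (t + 1) = N.hist π φ t := by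
  rw [hist, Function.iterate_succ_apply', iterate_step_eq_obs, step, h]
  exact dx_obs _ _ _

theorem hist_succ_of_some {π : Policy G} {φ : Realization G} {t : ℕ} {u : V}
    (h : π (obs N.k φ (N.hist π φ t)) = some u) :
    N.hist π φ (t + 1) = insert u (N.hist π φ t) := by
  rw [hist, Function.iterate_succ_apply', iterate_step_eq_obs, step, h]
  simp only [observe_obs, dx_obs]

theorem hist_subset_succ (π : Policy G) (φ : Realization G) (t : ℕ) :
    N.hist π φ t ⊆ N.hist π φ (t + 1) := by
  cases h : π (obs N.k φ (N.hist π φ t)) with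
  | none => rw [N.hist_succ_of_none h]
  | some u =>
    rw [N.hist_succ_of_some h]
    exact Finset.subset_insert _ _

theorem hist_mono (π : Policy G) (φ : Realization G) : Monotone (N.hist π φ) :=
  monotone_nat_of_le_succ (N.hist_subset_succ π φ)

theorem card_hist_le (π : Policy G) (φ : Realization G) (t : ℕ) : (N.hist π φ t).card ≤ t := by
  induction t with
  | zero => simp [hist_zero]
  | succ t ih =>
    cases h : π (obs N.k φ (N.hist π φ t)) with
    | none =>
      rw [N.hist_succ_of_none h]
      omega
    | some u =>
      rw [N.hist_succ_of_some h]
      exact (Finset.card_insert_le _ _).trans (Nat.succ_le_succ ih)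

/-- The first picks of a policy are determined by what they reveal. -/
theorem hist_eq_of_consistent {π : Policy G} {φ φ' : Realization G} {t : ℕ}
    (h : Consistent φ' (obs N.k φ (N.hist π φ t))) : N.hist π φ' t = N.hist π φ t := by
  induction t with
  | zero => rw [hist_zero, hist_zero]
  | succ t ih =>
    have h' := h.mono_obs (N.hist_subset_succ π φ t)
    have ih := ih h'
    have hobs : obs N.k φ' (N.hist π φ' t) = obs N.k φ (N.hist π φ t) := by
      rw [ih, consistent_obs_iff_eq.mp h']
    cases hπ : π (obs N.k φ (N.hist π φ t)) with
    | none => rw [N.hist_succ_of_none hπ, N.hist_succ_of_none (hobs ▸ hπ), ih]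
    | some u => rw [N.hist_succ_of_some hπ, N.hist_succ_of_some (hobs ▸ hπ), ih]

/-! ### Comparing a policy with the greedy pick -/

/-- No positivity is needed: on an observation of probability zero every summand vanishes. -/
theorem sum_marginal_eq (u : V) (ψ : PartialRealization G) :
    ∑ φ : Realization G with Consistent φ ψ,
      N.prob φ * (N.revenue (dx ψ ∪ {u}) φ - N.revenue (dx ψ) φ) =
        N.marginal u ψ * N.probConsistent ψ := by
  by_cases h : N.probConsistent ψ = 0
  · rw [h, mul_zero]
    refine Finset.sum_eq_zero fun φ hφ => ?_
    rw [(Finset.sum_eq_zero_iff_of_nonneg fun φ _ => N.prob_nonneg φ).mp h φ hφ, zero_mul]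
  · rw [marginal, div_mul_cancel₀ _ h]

/-- A pick of any policy, made after the users of `S` have been invited, gains at most as much as
the best user would have gained right after `S`. -/
theorem sum_gain_le (hcase : N.k ≤ 1 ∨ ∀ e : G.edgeSet, N.p e = 1) (π : Policy G)
    (φ₀ : Realization G) (S : Finset V) {M : ℝ} (hM0 : 0 ≤ M)
    (hM : 0 < N.probConsistent (obs N.k φ₀ S) → ∀ u ∉ S, N.marginal u (obs N.k φ₀ S) ≤ M)
    (t : ℕ) :
    ∑ φ : Realization G with Consistent φ (obs N.k φ₀ S),
        N.prob φ * (N.revenue (S ∪ N.hist π φ (t + 1)) φ - N.revenue (S ∪ N.hist π φ t) φ) ≤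
      ∑ φ : Realization G with Consistent φ (obs N.k φ₀ S),
        N.prob φ * (M * ((N.hist π φ (t + 1)).card - (N.hist π φ t).card)) := by
  -- Refine the conditioning to what `S` and the first `t` picks of `π` reveal together; then the
  -- next pick of `π` is fixed.
  refine sum_le_sum_of_observation (ρ := fun φ => obs N.k φ (S ∪ N.hist π φ t)) ?_ ?_
  · intro φ hφ φ'
    constructor
    · intro h
      have hS := consistent_obs_iff_eq.mp (h.mono_obs Finset.subset_union_left)
      refine ⟨consistent_obs_iff_eq.mpr (hS.trans (consistent_obs_iff_eq.mp hφ)), ?_⟩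
      rw [N.hist_eq_of_consistent (h.mono_obs Finset.subset_union_right),
        consistent_obs_iff_eq.mp h]
    · rintro ⟨-, h⟩
      rw [← h]
      exact consistent_obs_self _ _ _
  · intro φ hφ
    set T := N.hist π φ t with hT
    have hhist : ∀ φ', Consistent φ' (obs N.k φ (S ∪ T)) → N.hist π φ' t = T :=
      fun φ' h => N.hist_eq_of_consistent (h.mono_obs Finset.subset_union_right)
    have hobs : ∀ φ', Consistent φ' (obs N.k φ (S ∪ T)) →
        obs N.k φ' (N.hist π φ' t) = obs N.k φ T := by
      intro φ' h
      rw [hhist φ' h, consistent_obs_iff_eq.mp (h.mono_obs Finset.subset_union_right)]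
    -- A pick that stops, repeats, or falls in `S` gains nothing, while the right side is
    -- nonnegative.
    have htriv : (∀ φ', Consistent φ' (obs N.k φ (S ∪ T)) →
        S ∪ N.hist π φ' (t + 1) = S ∪ T) →
        ∑ φ' : Realization G with Consistent φ' (obs N.k φ (S ∪ T)),
          N.prob φ' * (N.revenue (S ∪ N.hist π φ' (t + 1)) φ' -
            N.revenue (S ∪ N.hist π φ' t) φ') ≤
        ∑ φ' : Realization G with Consistent φ' (obs N.k φ (S ∪ T)),
          N.prob φ' * (M * ((N.hist π φ' (t + 1)).card - (N.hist π φ' t).card)) := by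
      intro h
      refine Finset.sum_le_sum fun φ' hφ' => ?_
      have hc := (Finset.mem_filter.mp hφ').2
      rw [h φ' hc, hhist φ' hc, sub_self, mul_zero]
      refine mul_nonneg (N.prob_nonneg _) (mul_nonneg hM0 (sub_nonneg.mpr ?_))
      rw [← hhist φ' hc]
      exact_mod_cast Finset.card_le_card (N.hist_subset_succ π φ' t)
    cases hπ : π (obs N.k φ T) with
    | none =>
      refine htriv fun φ' h => ?_
      rw [N.hist_succ_of_none ((congrArg π (hobs φ' h)).trans hπ), hhist φ' h]
    | some u =>
      have hsucc : ∀ φ', Consistent φ' (obs N.k φ (S ∪ T)) →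
          N.hist π φ' (t + 1) = insert u T := by
        intro φ' h
        rw [N.hist_succ_of_some ((congrArg π (hobs φ' h)).trans hπ), hhist φ' h]
      by_cases hu : u ∈ S ∪ T
      · refine htriv fun φ' h => ?_
        rw [hsucc φ' h, Finset.union_insert, Finset.insert_eq_of_mem hu]
      · have hL : ∀ φ' ∈ Finset.univ.filter fun φ' => Consistent φ' (obs N.k φ (S ∪ T)),
            N.prob φ' * (N.revenue (S ∪ N.hist π φ' (t + 1)) φ' -
              N.revenue (S ∪ N.hist π φ' t) φ') =
            N.prob φ' * (N.revenue (dx (obs N.k φ (S ∪ T)) ∪ {u}) φ' -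
              N.revenue (dx (obs N.k φ (S ∪ T))) φ') := by
          intro φ' hφ'
          have hc := (Finset.mem_filter.mp hφ').2
          rw [hsucc φ' hc, hhist φ' hc, dx_obs, Finset.insert_eq u T, Finset.union_comm {u} T,
            Finset.union_assoc]
        have hR : ∀ φ' ∈ Finset.univ.filter fun φ' => Consistent φ' (obs N.k φ (S ∪ T)),
            N.prob φ' * (M * ((N.hist π φ' (t + 1)).card - (N.hist π φ' t).card)) =
            M * N.prob φ' := by
          intro φ' hφ'
          have hc := (Finset.mem_filter.mp hφ').2
          rw [hsucc φ' hc, hhist φ' hc,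
            Finset.card_insert_of_notMem fun h => hu (Finset.mem_union_right _ h)]
          push_cast
          ring
        rw [Finset.sum_congr rfl hL, Finset.sum_congr rfl hR, sum_marginal_eq, ← Finset.mul_sum]
        change _ ≤ M * N.probConsistent _
        rcases (N.probConsistent_nonneg (obs N.k φ (S ∪ T))).eq_or_lt with h0 | hpos
        · rw [← h0, mul_zero, mul_zero]
        · refine mul_le_mul_of_nonneg_right ?_ hpos.le
          have hpos' : 0 < N.probConsistent (obs N.k φ S) := by
            refine hpos.trans_le
              (Finset.sum_le_sum_of_subset_of_nonneg ?_ fun φ _ _ => N.prob_nonneg φ)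
            exact Finset.monotone_filter_right _ fun φ' _ h =>
              h.mono_obs Finset.subset_union_left
          refine (N.marginal_le_marginal hcase Finset.subset_union_left hu hpos).trans ?_
          -- Adaptive submodularity has moved the bound back to the observation of `S`, which is the
          -- same under `φ` and `φ₀`.
          rw [consistent_obs_iff_eq.mp hφ] at hpos' ⊢
          exact hM hpos' u fun h => hu (Finset.mem_union_left _ h)

/-- The conditional expected advantage of a feasible policy is at most `b` times the largest
marginal benefit. -/
theorem sum_advantage_le (hcase : N.k ≤ 1 ∨ ∀ e : G.edgeSet, N.p e = 1) {b : ℕ} {π : Policy G}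
    (hπ : N.Feasible b π) (φ₀ : Realization G) (S : Finset V) {M : ℝ} (hM0 : 0 ≤ M)
    (hM : 0 < N.probConsistent (obs N.k φ₀ S) → ∀ u ∉ S, N.marginal u (obs N.k φ₀ S) ≤ M) :
    ∑ φ : Realization G with Consistent φ (obs N.k φ₀ S),
        N.prob φ * (N.revenue (N.invited π φ) φ - N.revenue S φ) ≤
      b * (M * N.probConsistent (obs N.k φ₀ S)) := by
  have htel : ∀ φ, N.revenue (S ∪ N.invited π φ) φ - N.revenue S φ =
      ∑ t ∈ Finset.range (Fintype.card V),
        (N.revenue (S ∪ N.hist π φ (t + 1)) φ - N.revenue (S ∪ N.hist π φ t) φ) := by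
    intro φ
    rw [Finset.sum_range_sub fun t => N.revenue (S ∪ N.hist π φ t) φ, hist_zero,
      Finset.union_empty]
    rfl
  have hcard : ∀ φ, ((N.invited π φ).card : ℝ) = ∑ t ∈ Finset.range (Fintype.card V),
      (((N.hist π φ (t + 1)).card : ℝ) - (N.hist π φ t).card) := by
    intro φ
    rw [Finset.sum_range_sub fun t => ((N.hist π φ t).card : ℝ), hist_zero, Finset.card_empty,
      Nat.cast_zero, sub_zero]
    rfl
  calc _ ≤ ∑ φ : Realization G with Consistent φ (obs N.k φ₀ S),
        N.prob φ * (N.revenue (S ∪ N.invited π φ) φ - N.revenue S φ) :=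
        Finset.sum_le_sum fun φ _ => mul_le_mul_of_nonneg_left
          (sub_le_sub_right (N.revenue_mono φ Finset.subset_union_right) _) (N.prob_nonneg φ)
    _ = ∑ t ∈ Finset.range (Fintype.card V),
        ∑ φ : Realization G with Consistent φ (obs N.k φ₀ S),
          N.prob φ * (N.revenue (S ∪ N.hist π φ (t + 1)) φ -
            N.revenue (S ∪ N.hist π φ t) φ) := by
        rw [Finset.sum_comm]
        refine Finset.sum_congr rfl fun φ _ => ?_
        rw [htel, Finset.mul_sum]
    _ ≤ ∑ t ∈ Finset.range (Fintype.card V),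
        ∑ φ : Realization G with Consistent φ (obs N.k φ₀ S),
          N.prob φ * (M * ((N.hist π φ (t + 1)).card - (N.hist π φ t).card)) :=
        Finset.sum_le_sum fun t _ => N.sum_gain_le hcase π φ₀ S hM0 hM t
    _ = ∑ φ : Realization G with Consistent φ (obs N.k φ₀ S),
          N.prob φ * (M * (N.invited π φ).card) := by
        rw [Finset.sum_comm]
        refine Finset.sum_congr rfl fun φ _ => ?_
        rw [hcard, Finset.mul_sum, Finset.mul_sum]
    _ ≤ ∑ φ : Realization G with Consistent φ (obs N.k φ₀ S), N.prob φ * (M * b) := by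
        refine Finset.sum_le_sum fun φ _ => mul_le_mul_of_nonneg_left
          (mul_le_mul_of_nonneg_left ?_ hM0) (N.prob_nonneg φ)
        exact_mod_cast hπ φ
    _ = _ := by
        rw [← Finset.sum_mul, ← probConsistent]
        ring

theorem IsAdaptiveGreedy.card_hist_le {N : CollaborateGame G} {b : ℕ} {π : Policy G}
    (h : N.IsAdaptiveGreedy b π) (φ : Realization G) (t : ℕ) : (N.hist π φ t).card ≤ b := by
  induction t with
  | zero => simp [hist_zero]
  | succ t ih =>
    have hg := h (obs N.k φ (N.hist π φ t))
    split_ifs at hg with hc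
    · obtain ⟨u, hu, -⟩ := hg
      rw [N.hist_succ_of_some hu]
      rw [dx_obs] at hc
      -- Greedy picks only while strictly below the budget, so one more user still fits.
      exact (Finset.card_insert_le _ _).trans hc.1
    · rwa [N.hist_succ_of_none hg]

theorem IsAdaptiveGreedy.feasible {N : CollaborateGame G} {b : ℕ} {π : Policy G}
    (h : N.IsAdaptiveGreedy b π) : N.Feasible b π := fun φ => h.card_hist_le φ _

/-- One greedy pick closes a `1 / b` fraction of the gap to any feasible policy. -/
theorem IsAdaptiveGreedy.sum_gap_le {N : CollaborateGame G} {b : ℕ} {πs : Policy G}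
    (h : N.IsAdaptiveGreedy b πs) (hcase : N.k ≤ 1 ∨ ∀ e : G.edgeSet, N.p e = 1) {π : Policy G}
    (hπ : N.Feasible b π) {t : ℕ} (ht : t < b) :
    ∑ φ, N.prob φ * (N.revenue (N.invited π φ) φ - N.revenue (N.hist πs φ t) φ) ≤
      ∑ φ, N.prob φ * (b * (N.revenue (N.hist πs φ (t + 1)) φ -
        N.revenue (N.hist πs φ t) φ)) := by
  have key := sum_le_sum_of_observation (P := fun _ : Realization G => True)
    (ρ := fun φ => obs N.k φ (N.hist πs φ t))
    (F := fun φ => N.prob φ * (N.revenue (N.invited π φ) φ - N.revenue (N.hist πs φ t) φ))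
    (F' := fun φ => N.prob φ * (b * (N.revenue (N.hist πs φ (t + 1)) φ -
        N.revenue (N.hist πs φ t) φ))) ?_ ?_
  · simpa only [Finset.filter_true] using key
  · intro φ _ φ'
    simp only [true_and]
    refine ⟨fun hc => ?_, fun he => he ▸ consistent_obs_self _ _ _⟩
    rw [N.hist_eq_of_consistent hc, consistent_obs_iff_eq.mp hc]
  · intro φ _
    set S := N.hist πs φ t with hS
    have hhist : ∀ φ', Consistent φ' (obs N.k φ S) → N.hist πs φ' t = S :=
      fun φ' hc => N.hist_eq_of_consistent hc
    have hobs : ∀ φ', Consistent φ' (obs N.k φ S) →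
        obs N.k φ' (N.hist πs φ' t) = obs N.k φ S := by
      intro φ' hc
      rw [hhist φ' hc, consistent_obs_iff_eq.mp hc]
    have hL : ∀ φ' ∈ Finset.univ.filter fun φ' => Consistent φ' (obs N.k φ S),
        N.prob φ' * (N.revenue (N.invited π φ') φ' - N.revenue (N.hist πs φ' t) φ') =
          N.prob φ' * (N.revenue (N.invited π φ') φ' - N.revenue S φ') := by
      intro φ' hφ'
      rw [hhist φ' (Finset.mem_filter.mp hφ').2]
    rw [Finset.sum_congr rfl hL]
    have hg := h (obs N.k φ S)
    rw [dx_obs] at hg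
    by_cases huniv : S = Finset.univ
    -- With everybody invited there is no greedy pick, but M = 0 is a valid bound because no user is
    -- left.
    · refine (N.sum_advantage_le hcase hπ φ S le_rfl fun _ u hu => ?_).trans ?_
      · rw [huniv] at hu
        exact absurd (Finset.mem_univ u) hu
      · rw [zero_mul, mul_zero]
        refine Finset.sum_nonneg fun φ' _ => mul_nonneg (N.prob_nonneg _)
          (mul_nonneg (Nat.cast_nonneg _) (sub_nonneg.mpr ?_))
        exact N.revenue_mono φ' (N.hist_subset_succ πs φ' t)
    -- After t < b picks fewer than b users are invited, so greedy does not stop, and M is the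
    -- marginal benefit of its pick.
    · rw [if_pos ⟨(N.card_hist_le πs φ t).trans_lt ht, huniv⟩] at hg
      obtain ⟨u, hu, -, hmax⟩ := hg
      refine (N.sum_advantage_le hcase hπ φ S (N.marginal_nonneg u _)
        fun hpos v hv => hmax hpos v hv).trans (le_of_eq ?_)
      rw [← sum_marginal_eq, dx_obs, Finset.mul_sum]
      refine Finset.sum_congr rfl fun φ' hφ' => ?_
      have hc := (Finset.mem_filter.mp hφ').2
      rw [N.hist_succ_of_some ((congrArg πs (hobs φ' hc)).trans hu), hhist φ' hc,
        Finset.insert_eq, Finset.union_comm {u} S]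
      ring

/-! ### Geometric decay of the gap -/

theorem favg_nonneg (π : Policy G) : 0 ≤ N.favg π :=
  Finset.sum_nonneg fun φ _ => mul_nonneg (N.prob_nonneg φ) (N.revenue_nonneg φ _)

theorem IsAdaptiveGreedy.le_favg {N : CollaborateGame G} {b : ℕ} {πs : Policy G}
    (h : N.IsAdaptiveGreedy b πs) (hcase : N.k ≤ 1 ∨ ∀ e : G.edgeSet, N.p e = 1)
    (hb : b ≤ Fintype.card V) {π : Policy G} (hπ : N.Feasible b π) :
    (1 - 1 / Real.exp 1) * N.favg π ≤ N.favg πs := by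
  set F : ℕ → ℝ := fun t => ∑ φ, N.prob φ * N.revenue (N.hist πs φ t) φ with hF
  have hF0 : F 0 = 0 := by simp [hF, hist_zero, revenue_empty]
  -- A run is defined by |V| picks, so b ≤ |V| and monotonicity place the first b picks inside it.
  have hFb : F b ≤ N.favg πs := Finset.sum_le_sum fun φ _ => mul_le_mul_of_nonneg_left
    (N.revenue_mono φ (N.hist_mono πs φ hb)) (N.prob_nonneg φ)
  have hstep : ∀ t < b, N.favg π - F t ≤ b * (F (t + 1) - F t) := by
    intro t ht
    have := h.sum_gap_le hcase hπ ht
    simp only [mul_sub, Finset.sum_sub_distrib, mul_left_comm _ (b : ℝ), ← Finset.mul_sum] at this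
    rw [mul_sub]
    exact this
  -- The contraction factor 1 - 1/b needs b > 0; with budget zero no revenue is possible.
  rcases Nat.eq_zero_or_pos b with rfl | hbpos
  · have hz : N.favg π = 0 := by
      refine Finset.sum_eq_zero fun φ _ => ?_
      rw [Finset.card_eq_zero.mp (Nat.le_zero.mp (hπ φ)), revenue_empty, mul_zero]
    rw [hz, mul_zero]
    exact N.favg_nonneg πs
  have hb1 : (1 : ℝ) ≤ b := by exact_mod_cast hbpos
  have hb0 : (0 : ℝ) < b := by linarith
  have hc0 : (0 : ℝ) ≤ 1 - 1 / b := sub_nonneg.mpr ((div_le_one hb0).mpr hb1)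
  have hgap : ∀ t ≤ b, N.favg π - F t ≤ (1 - 1 / (b : ℝ)) ^ t * N.favg π := by
    intro t ht
    induction t with
    | zero => simp [hF0]
    | succ t ih =>
      have h1 := ih (Nat.le_of_succ_le ht)
      have h2 : (N.favg π - F t) / b ≤ F (t + 1) - F t := (div_le_iff₀' hb0).mpr (hstep t ht)
      calc N.favg π - F (t + 1) ≤ (1 - 1 / (b : ℝ)) * (N.favg π - F t) := by
            rw [sub_mul, one_mul, one_div_mul_eq_div]
            linarith
        _ ≤ (1 - 1 / (b : ℝ)) * ((1 - 1 / (b : ℝ)) ^ t * N.favg π) :=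
            mul_le_mul_of_nonneg_left h1 hc0
        _ = _ := by ring
  have hexp : (1 - 1 / (b : ℝ)) ^ b ≤ 1 / Real.exp 1 := by
    rw [one_div (Real.exp 1), ← Real.exp_neg]
    exact Real.one_sub_div_pow_le_exp_neg hb1
  have h3 := (hgap b le_rfl).trans (mul_le_mul_of_nonneg_right hexp (N.favg_nonneg π))
  rw [sub_mul, one_mul]
  linarith

/-- A budget larger than the number of users is as good as that number. -/
theorem IsAdaptiveGreedy.min_card {N : CollaborateGame G} {b : ℕ} {πs : Policy G}
    (h : N.IsAdaptiveGreedy b πs) : N.IsAdaptiveGreedy (min b (Fintype.card V)) πs := by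
  intro ψ
  have hiff : ((dx ψ).card < min b (Fintype.card V) ∧ dx ψ ≠ Finset.univ) ↔
      ((dx ψ).card < b ∧ dx ψ ≠ Finset.univ) := by
    rw [lt_min_iff]
    exact ⟨fun hc => ⟨hc.1.1, hc.2⟩,
      fun hc => ⟨⟨hc.1, (Finset.card_lt_iff_ne_univ _).mpr hc.2⟩, hc.2⟩⟩
  rw [if_congr hiff rfl rfl]
  exact h ψ

end CollaborateGame

end

theorem theorem2 {V : Type*} [Fintype V] [DecidableEq V] (G : SimpleGraph V) [DecidableRel G.Adj]
    (N : CollaborateGame G) (b : ℕ) (hcase : N.k ≤ 1 ∨ ∀ e : G.edgeSet, N.p e = 1)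
    (πs : Policy G) (hπs : N.IsAdaptiveGreedy b πs) :
    N.Feasible b πs ∧
      ∀ π : Policy G, N.Feasible b π → (1 - 1 / Real.exp 1) * N.favg π ≤ N.favg πs := by
  refine ⟨hπs.feasible, fun π hπ => ?_⟩
  -- Capping the budget at |V| loses no competitor, since no policy invites more than |V| users.
  exact hπs.min_card.le_favg hcase (min_le_right _ _)
    fun φ => le_min (hπ φ) (Finset.card_le_univ _)
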